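/- Let $G\subseteq \mathrm{GL}(d,\mathbb{C})$ be a compact connected matrix Lie group, i.e. a closed subgroup of $\mathrm{GL}(d,\mathbb{C})$ that is compact and connected, with Lie algebra $\mathfrak{g}=\{A\in\mathbb{C}^{d\times d} : e^{tA}\in G \text{ for all } t\in\mathbb{R}\}$, a real vector space. Let $V$ be a finite-dimensional complex Hilbert space and $\phi:G\to \mathrm{U}(V)$ a continuous unitary representation. Write $\mathfrak{u}(V)$ for the skew-adjoint operators on $V$. Then for every $A\in\mathfrak{g}$ the derivative $$\phi'(A)=\frac{d}{dt}\Big|_{t=0}\phi(e^{tA})$$ exists, $\phi':\mathfrak{g}\to\mathfrak{u}(V)$ is a real-linear map, and $\phi'$ is injective if $\phi$ is. For every $v\in V$ the orbit $\{\phi(g)v : g\in G\}$ is compact and is a smooth embedded submanifold of $V$ (that is, with the subspace topology it carries a smooth structure of some dimension $r$ for which the inclusion into $V$ is a smooth embedding), and its dimension is $$\dim\{\phi(g)v : g\in G\}=\dim_{\mathbb{R}}\operatorname{span}_{\mathbb{R}}\{\phi'(H_1)v,\dots,\phi'(H_k)v\}$$ for any basis $\{H_1,\dots,H_k\}$ of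 $\mathfrak{g}$. In particular, suppose that $G\subseteq \mathrm{U}(d)$; then $\mathfrak{g}\subseteq\mathfrak{u}(d)$, the skew-Hermitian matrices. 1. The defining representation $\phi(g)=g$ of $G$ on $\mathbb{C}^d$ is a continuous unitary representation and $\phi'(A)=A$ for all $A\in\mathfrak{g}$. 2. The adjoint representation $\phi(g)=(B\mapsto gBg^{-1})$ of $G$ on $\mathfrak{g}$, a real Hilbert space with the inner product $\langle A,B\rangle=\operatorname{Re}\operatorname{tr}(A^\dagger B)$, is a continuous representation by orthogonal operators; for all $A\in\mathfrak{g}$ the derivative $\phi'(A)$ exists, is skew-adjoint and equals $B\mapsto [A,B]=AB-BA$. For every $B\in\mathfrak{g}$ the orbit $\{gBg^{-1} : g\in G\}$ is compact and is a smooth embedded submanifold of $\mathfrak{g}$, of dimension $\dim_{\mathbb{R}}\operatorname{span}_{\mathbb{R}}\{[H_1,B],\dots,[H_k,B]\}$ for any basis $\{H_1,\dots,H_k\}$ of $\mathfrak{g}$. -/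

import Mathlib

open Matrix Topology Filter
open scoped Manifold ContDiff

noncomputable section

namespace OrbitRank

/-! ### The Lie algebra of a matrix Lie group -/

/-- The matrix exponential, as an element of `GL(d, ℂ)`. -/
def expGL {d : ℕ} (A : Matrix (Fin d) (Fin d) ℂ) : GL (Fin d) ℂ where
  val := NormedSpace.exp A
  inv := NormedSpace.exp (-A)
  val_inv := by
    rw [← Matrix.exp_add_of_commute _ _ (Commute.neg_right (Commute.refl A)), add_neg_cancel,
      NormedSpace.exp_zero]
  inv_val := by
    rw [← Matrix.exp_add_of_commute _ _ (Commute.neg_left (Commute.refl A)), neg_add_cancel,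
      NormedSpace.exp_zero]

theorem expGL_zero {d : ℕ} : expGL (0 : Matrix (Fin d) (Fin d) ℂ) = 1 := by
  ext1
  simp [expGL, NormedSpace.exp_zero]

theorem expGL_nsmul {d : ℕ} (n : ℕ) (A : Matrix (Fin d) (Fin d) ℂ) :
    expGL ((n : ℝ) • A) = expGL A ^ n := by
  ext1
  rw [Units.val_pow_eq_pow_val]
  simp only [expGL]
  rw [← Matrix.exp_nsmul, Nat.cast_smul_eq_nsmul]

theorem expGL_conj {d : ℕ} (g : GL (Fin d) ℂ) (A : Matrix (Fin d) (Fin d) ℂ) :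
    expGL ((g : Matrix (Fin d) (Fin d) ℂ) * A * ((g⁻¹ : GL (Fin d) ℂ) : Matrix (Fin d) (Fin d) ℂ))
      = g * expGL A * g⁻¹ := by
  ext1
  simpa [expGL] using Matrix.exp_units_conj g A

section
open scoped Matrix.Norms.Operator

theorem continuous_expGL {d : ℕ} :
    Continuous (expGL : Matrix (Fin d) (Fin d) ℂ → GL (Fin d) ℂ) := by
  have h : Continuous (NormedSpace.exp : Matrix (Fin d) (Fin d) ℂ → _) :=
    NormedSpace.exp_continuous
  exact Units.continuous_iff.2 ⟨h, h.comp continuous_neg⟩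

theorem tendsto_lie_product {d : ℕ} (A B : Matrix (Fin d) (Fin d) ℂ) :
    Tendsto (fun n : ℕ => (expGL ((n : ℝ)⁻¹ • A) * expGL ((n : ℝ)⁻¹ • B)) ^ n) atTop
      (𝓝 (expGL (A + B))) := by
  let M := Matrix (Fin d) (Fin d) ℂ
  have hexp : HasStrictFDerivAt (𝕜 := ℝ) (NormedSpace.exp : M → M)
      ((ContinuousLinearEquiv.refl ℝ M : M ≃L[ℝ] M) : M →L[ℝ] M) 0 :=
    hasStrictFDerivAt_exp_zero
  set L := hexp.localInverse
  have hL : HasFDerivAt L (ContinuousLinearMap.id ℝ M) 1 := by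
    have := hexp.to_localInverse.hasFDerivAt
    rw [NormedSpace.exp_zero] at this
    exact this
  have hright : ∀ᶠ y in 𝓝 (1 : M), NormedSpace.exp (L y) = y := by
    have := hexp.eventually_right_inverse
    rwa [NormedSpace.exp_zero] at this
  have hL1 : L 1 = 0 := by
    have := hexp.localInverse_apply_image
    rwa [NormedSpace.exp_zero] at this
  let c : ℝ → M := fun t => NormedSpace.exp (t • A) * NormedSpace.exp (t • B)
  have hc0 : c 0 = 1 := by simp [c, NormedSpace.exp_zero]
  have hc : HasDerivAt c (A + B) 0 := by
    have h1 := hasDerivAt_exp_smul_const (𝕂 := ℝ) A (0 : ℝ)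
    have h2 := hasDerivAt_exp_smul_const (𝕂 := ℝ) B (0 : ℝ)
    have h3 := h1.mul h2
    simp only [zero_smul, NormedSpace.exp_zero, one_mul, mul_one] at h3
    exact h3
  have hLc : HasDerivAt (fun t => L (c t)) (A + B) 0 := by
    have := HasFDerivAt.comp_hasDerivAt (x := (0 : ℝ)) (l := L) (f := c) (by rw [hc0]; exact hL) hc
    exact this
  have hinv : Tendsto (fun n : ℕ => ((n : ℝ)⁻¹)) atTop (𝓝 0) := tendsto_inv_atTop_nhds_zero_nat
  have hlim : Tendsto (fun n : ℕ => (n : ℝ) • L (c ((n : ℝ)⁻¹))) atTop (𝓝 (A + B)) := by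
    have h := hasDerivAt_iff_tendsto_slope.1 hLc
    have h2 : Tendsto (fun n : ℕ => ((n : ℝ)⁻¹)) atTop (𝓝[≠] 0) := by
      refine tendsto_nhdsWithin_iff.2 ⟨hinv, ?_⟩
      filter_upwards [eventually_gt_atTop 0] with n hn
      have : (n : ℝ) ≠ 0 := by positivity
      simpa using hn.ne'
    refine (h.comp h2).congr fun n => ?_
    simp [slope, hc0, hL1]
  refine ((continuous_expGL.tendsto _).comp hlim).congr' ?_
  have hcn : Tendsto (fun n : ℕ => c ((n : ℝ)⁻¹)) atTop (𝓝 1) := by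
    have := hc.continuousAt.tendsto.comp hinv
    rwa [hc0] at this
  filter_upwards [hcn.eventually hright] with n hn
  simp only [Function.comp_apply]
  rw [expGL_nsmul]
  congr 1
  ext1
  exact hn

end

/-- The Lie algebra `{A | ∀ t : ℝ, exp (t A) ∈ G}` of a matrix Lie group `G`, that is, of a
closed subgroup `G` of `GL(d, ℂ)`, as a real subspace of the space of all matrices. -/
def lieAlgebra {d : ℕ} (G : Subgroup (GL (Fin d) ℂ)) (hG : IsClosed (G : Set (GL (Fin d) ℂ))) :
    Submodule ℝ (Matrix (Fin d) (Fin d) ℂ) where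
  carrier := {A | ∀ t : ℝ, expGL (t • A) ∈ G}
  zero_mem' := fun t => by
    rw [smul_zero, expGL_zero]
    exact G.one_mem
  add_mem' := fun {A B} hA hB t => by
    rw [smul_add]
    refine hG.mem_of_tendsto (tendsto_lie_product (t • A) (t • B)) (Eventually.of_forall fun n => ?_)
    refine G.pow_mem (G.mul_mem ?_ ?_) n
    · rw [smul_smul]; exact hA _
    · rw [smul_smul]; exact hB _
  smul_mem' := fun s A hA t => by
    rw [smul_smul]
    exact hA _

/-- The one-parameter subgroup `t ↦ exp (t A)` of `G`, for `A` in the Lie algebra of `G`. -/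
def expCurve {d : ℕ} {G : Subgroup (GL (Fin d) ℂ)} {hG : IsClosed (G : Set (GL (Fin d) ℂ))}
    (A : lieAlgebra G hG) (t : ℝ) : G :=
  ⟨expGL (t • (A : Matrix (Fin d) (Fin d) ℂ)), A.2 t⟩

/-! ### Representations, their differentials and their orbits -/

/-- The differential `φ'(A) = d/dt φ(exp (t A))` at `t = 0` of a representation `φ` of `G` by
unitary elements of a `*`-ring `R` (such as the bounded operators of a Hilbert space). -/
def repDeriv {d : ℕ} {G : Subgroup (GL (Fin d) ℂ)} {hG : IsClosed (G : Set (GL (Fin d) ℂ))}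
    {R : Type*} [NormedRing R] [StarRing R] [NormedSpace ℝ R] (φ : G →* unitary R)
    (A : lieAlgebra G hG) : R :=
  deriv (fun t : ℝ => (φ (expCurve A t) : R)) 0

/-- The orbit of `v` under the group `φ(G)` of unitary operators. -/
def repOrbit {𝕜 V Γ : Type*} [RCLike 𝕜] [NormedAddCommGroup V] [InnerProductSpace 𝕜 V]
    [CompleteSpace V] [Group Γ] (φ : Γ →* unitary (V →L[𝕜] V)) (v : V) : Set V :=
  {w | ∃ g : Γ, (φ g : V →L[𝕜] V) v = w}

/-- `S` is an `r`-dimensional smooth embedded submanifold of the normed space `E`: with the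
topology induced from `E`, it carries an `r`-dimensional smooth structure for which the inclusion
into `E` is a smooth embedding. -/
def IsEmbeddedSubmanifold {E : Type*} [NormedAddCommGroup E] [NormedSpace ℝ E]
    (r : ℕ) (S : Set E) : Prop :=
  ∃ _ : ChartedSpace (EuclideanSpace ℝ (Fin r)) S,
    IsManifold (𝓡 r) ∞ S ∧ Manifold.IsSmoothEmbedding (𝓡 r) 𝓘(ℝ, E) ∞ (Subtype.val : S → E)

/-! ### The defining and the adjoint representation of a group of unitary matrices -/

/-- The defining representation of a group `G` of unitary matrices, on `ℂ^d`. -/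
def definingRep {d : ℕ} (G : Subgroup (GL (Fin d) ℂ))
    (hU : ∀ g ∈ G, (g : Matrix (Fin d) (Fin d) ℂ) ∈ unitaryGroup (Fin d) ℂ) :
    G →* unitary (EuclideanSpace ℂ (Fin d) →L[ℂ] EuclideanSpace ℂ (Fin d)) where
  toFun g := ⟨toEuclideanCLM (n := Fin d) (𝕜 := ℂ) (g : GL (Fin d) ℂ).val,
    Unitary.map_mem (toEuclideanCLM (n := Fin d) (𝕜 := ℂ)) (hU g g.2)⟩
  map_one' := by ext1; simp
  map_mul' g h := by ext1; simp

section

variable {d : ℕ} {G : Subgroup (GL (Fin d) ℂ)} {hG : IsClosed (G : Set (GL (Fin d) ℂ))}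

/-- The Hilbert-Schmidt inner product `Re tr (Aᴴ B)` on the Lie algebra. -/
@[reducible] def lieAlgebraCore : InnerProductSpace.Core ℝ (lieAlgebra G hG) where
  inner A B := (trace (A.valᴴ * B.val)).re
  conj_inner_symm A B := by
    rw [conj_trivial, ← Complex.conj_re, ← Complex.star_def, ← trace_conjTranspose,
      conjTranspose_mul, conjTranspose_conjTranspose]
  re_inner_nonneg A := by
    simp only [trace, diag_apply, mul_apply, conjTranspose_apply, Complex.re_sum, RCLike.re_to_real]
    refine Finset.sum_nonneg fun i _ => Finset.sum_nonneg fun j _ => ?_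
    rw [Complex.star_def, Complex.conj_mul']
    norm_cast
    positivity
  add_left A B C := by simp [add_mul]
  smul_left A B r := by simp
  definite A h := by
    apply Subtype.val_injective
    have h0 : (trace (A.valᴴ * A.val)).im = 0 := by
      rw [← Complex.conj_eq_iff_im, ← Complex.star_def, ← trace_conjTranspose,
        conjTranspose_mul, conjTranspose_conjTranspose]
    have h1 : trace (A.valᴴ * A.val) = 0 := Complex.ext h h0
    open scoped ComplexOrder in
    exact Matrix.trace_conjTranspose_mul_self_eq_zero_iff.1 h1

variable (G hG) in
/-- The Lie algebra of `G`, as a real Hilbert space with the Hilbert-Schmidt inner product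
`Re tr (Aᴴ B)`. -/
def LieAlgebraSpace : Type := lieAlgebra G hG

instance : NormedAddCommGroup (LieAlgebraSpace G hG) :=
  (lieAlgebraCore : InnerProductSpace.Core ℝ (lieAlgebra G hG)).toNormedAddCommGroup

instance : InnerProductSpace ℝ (LieAlgebraSpace G hG) :=
  InnerProductSpace.ofCore (lieAlgebraCore : InnerProductSpace.Core ℝ (lieAlgebra G hG)).toCore

/-- The matrix underlying an element of the Lie algebra. -/
def LieAlgebraSpace.toMatrix : LieAlgebraSpace G hG →ₗ[ℝ] Matrix (Fin d) (Fin d) ℂ where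
  toFun A := (show lieAlgebra G hG from A).val
  map_add' _ _ := rfl
  map_smul' _ _ := rfl

theorem LieAlgebraSpace.toMatrix_injective :
    Function.Injective (LieAlgebraSpace.toMatrix (G := G) (hG := hG)) :=
  Subtype.val_injective

instance : FiniteDimensional ℝ (LieAlgebraSpace G hG) :=
  FiniteDimensional.of_injective LieAlgebraSpace.toMatrix LieAlgebraSpace.toMatrix_injective

instance : CompleteSpace (LieAlgebraSpace G hG) :=
  FiniteDimensional.complete ℝ _

theorem LieAlgebraSpace.inner_eq (A B : LieAlgebraSpace G hG) :
    inner ℝ A B = (trace (A.toMatrixᴴ * B.toMatrix)).re := rfl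

/-- Conjugation by an element of `G`, as a linear map of the Lie algebra. -/
def conjLinear (g : G) : LieAlgebraSpace G hG →ₗ[ℝ] LieAlgebraSpace G hG :=
  { toFun := fun A => show lieAlgebra G hG from
      ⟨(g : GL (Fin d) ℂ).val * A.toMatrix * (g⁻¹ : GL (Fin d) ℂ).val, fun t => by
        have h : t • ((g : GL (Fin d) ℂ).val * A.toMatrix * (g⁻¹ : GL (Fin d) ℂ).val) =
            (g : GL (Fin d) ℂ).val * (t • A.toMatrix) * (g⁻¹ : GL (Fin d) ℂ).val := by
          simp
        rw [h, expGL_conj]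
        exact G.mul_mem (G.mul_mem g.2 (A.2 t)) (G.inv_mem g.2)⟩
    map_add' := fun A B => Subtype.ext <| by
      change _ * (A + B).toMatrix * _ = _ * A.toMatrix * _ + _ * B.toMatrix * _
      rw [map_add, mul_add, add_mul]
    map_smul' := fun r A => Subtype.ext <| by
      change _ * (r • A).toMatrix * _ = r • (_ * A.toMatrix * _)
      rw [map_smul, Matrix.mul_smul, Matrix.smul_mul] }

theorem toMatrix_conjLinear (g : G) (A : LieAlgebraSpace G hG) :
    (conjLinear g A).toMatrix =
      (g : GL (Fin d) ℂ).val * A.toMatrix * (g⁻¹ : GL (Fin d) ℂ).val :=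
  rfl

theorem conjLinear_mul (g h : G) (A : LieAlgebraSpace G hG) :
    conjLinear (g * h) A = conjLinear g (conjLinear h A) := by
  apply LieAlgebraSpace.toMatrix_injective
  simp only [toMatrix_conjLinear, Subgroup.coe_mul, _root_.mul_inv_rev, Units.val_mul, mul_assoc]

theorem conjLinear_one (A : LieAlgebraSpace G hG) : conjLinear (1 : G) A = A := by
  apply LieAlgebraSpace.toMatrix_injective
  simp [toMatrix_conjLinear]

/-- Conjugation by an element of a group of unitary matrices, as an isometry of the Lie algebra. -/
def conjIsometry (hU : ∀ g ∈ G, (g : Matrix (Fin d) (Fin d) ℂ) ∈ unitaryGroup (Fin d) ℂ) (g : G) :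
    LieAlgebraSpace G hG ≃ₗᵢ[ℝ] LieAlgebraSpace G hG :=
  LinearEquiv.isometryOfInner
    { conjLinear (hG := hG) g with
      invFun := conjLinear g⁻¹
      left_inv := fun A => by
        change conjLinear g⁻¹ (conjLinear g A) = A
        rw [← conjLinear_mul, inv_mul_cancel, conjLinear_one]
      right_inv := fun A => by
        change conjLinear g (conjLinear g⁻¹ A) = A
        rw [← conjLinear_mul, mul_inv_cancel, conjLinear_one] }
    (fun A B => by
      change inner ℝ (conjLinear g A) (conjLinear g B) = inner ℝ A B
      have h1 : (g : GL (Fin d) ℂ).valᴴ * (g : GL (Fin d) ℂ).val = 1 :=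
        (mem_unitaryGroup_iff' (A := (g : GL (Fin d) ℂ).val)).1 (hU g g.2)
      have h2 : (g⁻¹ : GL (Fin d) ℂ).val * (g⁻¹ : GL (Fin d) ℂ).valᴴ = 1 :=
        (mem_unitaryGroup_iff (A := (g⁻¹ : GL (Fin d) ℂ).val)).1 (hU _ (G.inv_mem g.2))
      rw [LieAlgebraSpace.inner_eq, LieAlgebraSpace.inner_eq, toMatrix_conjLinear,
        toMatrix_conjLinear, conjTranspose_mul, conjTranspose_mul, mul_assoc, trace_mul_comm]
      congr 2
      calc _ = A.toMatrixᴴ * ((g : GL (Fin d) ℂ).valᴴ * (g : GL (Fin d) ℂ).val) * B.toMatrix *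
            ((g⁻¹ : GL (Fin d) ℂ).val * (g⁻¹ : GL (Fin d) ℂ).valᴴ) := by
            simp only [mul_assoc]
        _ = _ := by rw [h1, h2, mul_one, mul_one])

end

/-- The adjoint representation `g ↦ (A ↦ g A g⁻¹)` of a closed group `G` of unitary matrices, on
its Lie algebra with the Hilbert-Schmidt inner product. -/
def adjointRep {d : ℕ} (G : Subgroup (GL (Fin d) ℂ)) (hG : IsClosed (G : Set (GL (Fin d) ℂ)))
    (hU : ∀ g ∈ G, (g : Matrix (Fin d) (Fin d) ℂ) ∈ unitaryGroup (Fin d) ℂ) :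
    G →* unitary (LieAlgebraSpace G hG →L[ℝ] LieAlgebraSpace G hG) :=
  Unitary.linearIsometryEquiv.symm.toMonoidHom.comp
    { toFun := conjIsometry hU
      map_one' := LinearIsometryEquiv.ext fun A => conjLinear_one A
      map_mul' := fun g h => LinearIsometryEquiv.ext fun A => conjLinear_mul g h A }

end OrbitRank
end

open OrbitRank

/-! A continuous homomorphism `ρ` into a Banach algebra carries `t ↦ exp (tA)` to a continuous
one-parameter group, which must be `t ↦ exp (t D(A))` (`exists_eq_exp_smul_of_continuous`). The Lie
product formula holds in `G` and in the target, so `D` is linear (`exists_differential`). Unitarity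
makes `D(A)` skew-adjoint, and faithfulness makes `D` injective because `A` is determined by its
one-parameter group.

For the orbit of `v`, let `L A = D(A) v`. Its kernel is infinitesimally the stabilizer and its range
is the tangent space at `v`. With `j` a linear section of `L` over its range and `C` a complement of
the range, `(u, c) ↦ exp (D (j u)) v + c` is a local diffeomorphism at `0` sending `c = 0` into the
orbit. The orbit must also have no other points near `v`. By compactness, orbit points near `v` are
`g v` with `g` near `1` (`eventually_exists_mem_nhds_apply_eq`). By von Neumann's closed subgroup
argument, such a `g` is `exp (j u) exp Y` with `u` small and `L Y = 0`
(`eventually_exists_eq_expCurve_mul`), and `exp Y` fixes `v`. So the orbit is a slice at `v`; the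
group moves this slice to every other point, and slices provide the charts. The dimension is the
rank of `L`. -/

/-! ### One-parameter groups and the differential of a homomorphism. -/

section BanachAlgebra

variable {R : Type*} [NormedRing R] [NormedAlgebra ℝ R] [CompleteSpace R]

/-- A continuous one-parameter group in a Banach algebra is `t ↦ exp (t X)` for some `X`. -/
theorem exists_eq_exp_smul_of_continuous {f : ℝ → R} (hf : Continuous f) (h0 : f 0 = 1)
    (hadd : ∀ s t, f (s + t) = f s * f t) : ∃ X : R, ∀ t, f t = NormedSpace.exp (t • X) := by
  -- Integration regularizes `f`: `f s * F ε = F (s + ε) - F s`, and `F ε` is invertible for a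
  -- suitable `ε` since `F ε / ε → f 0 = 1`. Hence `f` inherits differentiability from `F`.
  let F : ℝ → R := fun s => ∫ u in (0 : ℝ)..s, f u
  have hF : ∀ s, HasDerivAt F (f s) s := fun s => hf.integral_hasStrictDerivAt 0 s |>.hasDerivAt
  obtain ⟨ε, J, hJ⟩ : ∃ (ε : ℝ) (J : Rˣ), (J : R) = F ε := by
    have h := hasDerivAt_iff_tendsto_slope.1 (hF 0)
    rw [h0] at h
    have hu : ∀ᶠ x : R in 𝓝 1, IsUnit x := Units.isOpen.mem_nhds isUnit_one
    obtain ⟨ε, hε, hne⟩ := ((h.eventually hu).and self_mem_nhdsWithin).exists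
    have hF0 : F 0 = 0 := by simp [F]
    have hne : ε ≠ 0 := hne
    simp only [slope, sub_zero, hF0, vsub_eq_sub] at hε
    have : IsUnit (F ε) := by
      have h2 := hε.smul (Units.mk0 ε hne)
      rwa [Units.smul_def, Units.val_mk0, smul_smul, mul_inv_cancel₀ hne, one_smul] at h2
    exact ⟨ε, this.unit, rfl⟩
  have hfJ : ∀ s, f s = (F (s + ε) - F s) * (J⁻¹ : Rˣ) := by
    intro s
    rw [Units.eq_mul_inv_iff_mul_eq, hJ]
    have hi : ∀ a b, IntervalIntegrable f MeasureTheory.volume a b := hf.intervalIntegrable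
    have h1 : F (s + ε) - F s = ∫ u in s..(s + ε), f u :=
      intervalIntegral.integral_interval_sub_left (hi _ _) (hi _ _)
    rw [h1]
    have h2 := intervalIntegral.integral_comp_add_left (a := 0) (b := ε) f s
    rw [add_zero] at h2
    rw [← h2]
    simp only [hadd, F]
    exact ((ContinuousLinearMap.mul ℝ R (f s)).intervalIntegral_comp_comm (hi _ _)).symm
  let X : R := (f ε - 1) * (J⁻¹ : Rˣ)
  have hd : ∀ s, HasDerivAt f (f s * X) s := by
    intro s
    have h := (((hF (s + ε)).comp_add_const s ε).sub (hF s)).mul_const ((J⁻¹ : Rˣ) : R)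
    have hfun : f = fun s => (F (s + ε) - F s) * ((J⁻¹ : Rˣ) : R) := funext hfJ
    have h2 : f s * X = (f (s + ε) - f s) * ((J⁻¹ : Rˣ) : R) := by
      rw [hadd]; simp only [X]; noncomm_ring
    rw [h2]
    exact (congrArg (fun g => HasDerivAt g ((f (s + ε) - f s) * ((J⁻¹ : Rˣ) : R)) s) hfun).mpr h
  refine ⟨X, fun t => ?_⟩
  have hg : ∀ s, HasDerivAt (fun t : ℝ => f t * NormedSpace.exp (t • (-X))) 0 s := by
    intro s
    have h := (hd s).mul (hasDerivAt_exp_smul_const' (𝕂 := ℝ) (-X) s)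
    have h0 : f s * X * NormedSpace.exp (s • -X) + f s * (-X * NormedSpace.exp (s • -X)) = 0 := by
      noncomm_ring
    rw [h0] at h
    exact h
  have hc := is_const_of_deriv_eq_zero (fun s => (hg s).differentiableAt) (fun s => (hg s).deriv) t 0
  simp only [zero_smul, NormedSpace.exp_zero, mul_one, h0] at hc
  let +nondep : NormedAlgebra ℚ R := .restrictScalars ℚ ℝ R
  have hinv : NormedSpace.exp (t • (-X)) * NormedSpace.exp (t • X) = 1 := by
    rw [smul_neg, ← NormedSpace.exp_add_of_commute (Commute.neg_left (Commute.refl _)),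
      neg_add_cancel, NormedSpace.exp_zero]
  calc f t = f t * (NormedSpace.exp (t • (-X)) * NormedSpace.exp (t • X)) := by rw [hinv, mul_one]
    _ = _ := by rw [← mul_assoc, hc, one_mul]

theorem hasDerivAt_exp_smul_zero (X : R) :
    HasDerivAt (fun t : ℝ => NormedSpace.exp (t • X)) X 0 := by
  simpa [NormedSpace.exp_zero] using hasDerivAt_exp_smul_const (𝕂 := ℝ) X (0 : ℝ)

theorem eq_of_forall_exp_smul_eq {X Y : R}
    (h : ∀ t : ℝ, NormedSpace.exp (t • X) = NormedSpace.exp (t • Y)) : X = Y := by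
  have hX := hasDerivAt_exp_smul_zero X
  rw [show (fun t : ℝ => NormedSpace.exp (t • X)) = fun t : ℝ => NormedSpace.exp (t • Y) from
    funext h] at hX
  exact hX.unique (hasDerivAt_exp_smul_zero Y)

/-- The Lie product formula in a Banach algebra. -/
theorem tendsto_exp_mul_exp_pow (A B : R) :
    Tendsto (fun n : ℕ => (NormedSpace.exp ((n : ℝ)⁻¹ • A) * NormedSpace.exp ((n : ℝ)⁻¹ • B)) ^ n)
      atTop (𝓝 (NormedSpace.exp (A + B))) := by
  let +nondep : NormedAlgebra ℚ R := .restrictScalars ℚ ℝ R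
  have hexp : HasStrictFDerivAt (𝕜 := ℝ) (NormedSpace.exp : R → R)
      ((ContinuousLinearEquiv.refl ℝ R : R ≃L[ℝ] R) : R →L[ℝ] R) 0 :=
    hasStrictFDerivAt_exp_zero
  -- `L` is a local logarithm at `1`. For large `n`, `c (1/n) ^ n = exp (n • L (c (1/n)))`, and the
  -- exponent is a difference quotient of `L ∘ c` at `0`, with limit `A + B`.
  set L := hexp.localInverse
  have hL : HasFDerivAt L (ContinuousLinearMap.id ℝ R) 1 := by
    have := hexp.to_localInverse.hasFDerivAt
    rw [NormedSpace.exp_zero] at this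
    exact this
  have hright : ∀ᶠ y in 𝓝 (1 : R), NormedSpace.exp (L y) = y := by
    have := hexp.eventually_right_inverse
    rwa [NormedSpace.exp_zero] at this
  have hL1 : L 1 = 0 := by
    have := hexp.localInverse_apply_image
    rwa [NormedSpace.exp_zero] at this
  let c : ℝ → R := fun t => NormedSpace.exp (t • A) * NormedSpace.exp (t • B)
  have hc0 : c 0 = 1 := by simp [c, NormedSpace.exp_zero]
  have hc : HasDerivAt c (A + B) 0 := by
    have h3 := (hasDerivAt_exp_smul_zero A).mul (hasDerivAt_exp_smul_zero B)
    simp only [zero_smul, NormedSpace.exp_zero, one_mul, mul_one] at h3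
    exact h3
  have hLc : HasDerivAt (fun t => L (c t)) (A + B) 0 := by
    have := HasFDerivAt.comp_hasDerivAt (x := (0 : ℝ)) (l := L) (f := c) (by rw [hc0]; exact hL) hc
    exact this
  have hinv : Tendsto (fun n : ℕ => ((n : ℝ)⁻¹)) atTop (𝓝 0) := tendsto_inv_atTop_nhds_zero_nat
  have hlim : Tendsto (fun n : ℕ => (n : ℝ) • L (c ((n : ℝ)⁻¹))) atTop (𝓝 (A + B)) := by
    have h2 : Tendsto (fun n : ℕ => ((n : ℝ)⁻¹)) atTop (𝓝[≠] 0) := by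
      refine tendsto_nhdsWithin_iff.2 ⟨hinv, ?_⟩
      filter_upwards [eventually_gt_atTop 0] with n hn
      simpa using hn.ne'
    refine ((hasDerivAt_iff_tendsto_slope.1 hLc).comp h2).congr fun n => ?_
    simp [slope, hc0, hL1]
  refine ((NormedSpace.exp_continuous.tendsto _).comp hlim).congr' ?_
  have hcn : Tendsto (fun n : ℕ => c ((n : ℝ)⁻¹)) atTop (𝓝 1) := by
    have := hc.continuousAt.tendsto.comp hinv
    rwa [hc0] at this
  filter_upwards [hcn.eventually hright] with n hn
  simp only [Function.comp_apply]
  rw [Nat.cast_smul_eq_nsmul, NormedSpace.exp_nsmul, hn]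

variable {d : ℕ} {G : Subgroup (GL (Fin d) ℂ)} {hG : IsClosed (G : Set (GL (Fin d) ℂ))}

theorem expCurve_zero (A : lieAlgebra G hG) : expCurve A 0 = 1 :=
  Subtype.ext <| by simp [expCurve, expGL_zero]

theorem expCurve_add (A : lieAlgebra G hG) (s t : ℝ) :
    expCurve A (s + t) = expCurve A s * expCurve A t := by
  refine Subtype.ext (Units.ext ?_)
  simp only [expCurve, expGL, Subgroup.coe_mul, Units.val_mul]
  rw [← Matrix.exp_add_of_commute _ _ (((Commute.refl A.1).smul_left s).smul_right t), add_smul]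

theorem continuous_expCurve (A : lieAlgebra G hG) : Continuous (expCurve A) :=
  (continuous_expGL.comp (continuous_id.smul continuous_const)).subtype_mk _

theorem expCurve_smul (A : lieAlgebra G hG) (s t : ℝ) :
    expCurve (s • A) t = expCurve A (t * s) :=
  Subtype.ext <| by simp [expCurve, smul_smul]

theorem tendsto_expCurve_mul_pow (A B : lieAlgebra G hG) (t : ℝ) :
    Tendsto (fun n : ℕ => (expCurve A ((n : ℝ)⁻¹ * t) * expCurve B ((n : ℝ)⁻¹ * t)) ^ n) atTop
      (𝓝 (expCurve (A + B) t)) := by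
  rw [tendsto_subtype_rng]
  have h := tendsto_lie_product (t • A.1) (t • B.1)
  simp only [smul_smul, ← smul_add] at h
  exact h

/-- A continuous homomorphism from a matrix Lie group to a Banach algebra has a linear
differential. -/
theorem exists_differential {ρ : G →* R} (hρ : Continuous ρ) :
    ∃ D : lieAlgebra G hG →ₗ[ℝ] R, ∀ A t, ρ (expCurve A t) = NormedSpace.exp (t • D A) := by
  have h : ∀ A : lieAlgebra G hG, ∃ X : R, ∀ t, ρ (expCurve A t) = NormedSpace.exp (t • X) :=
    fun A => exists_eq_exp_smul_of_continuous (f := fun t => ρ (expCurve A t))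
      (hρ.comp (continuous_expCurve A)) (by simp [expCurve_zero])
      (fun s t => by simp [expCurve_add])
  choose D hD using h
  refine ⟨{ toFun := D, map_add' := fun A B => ?_, map_smul' := fun s A => ?_ }, hD⟩
  -- The image under `ρ` of the product formula in `G` is the product formula in `R`, term by term,
  -- so the limits agree.
  · refine eq_of_forall_exp_smul_eq fun t => ?_
    have h1 := (hρ.tendsto _).comp (tendsto_expCurve_mul_pow A B t)
    have h2 := tendsto_exp_mul_exp_pow (t • D A) (t • D B)
    rw [← smul_add] at h2
    rw [← hD]
    refine tendsto_nhds_unique h1 (h2.congr fun n => ?_)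
    simp [hD, smul_smul]
  · refine eq_of_forall_exp_smul_eq fun t => ?_
    rw [← hD, expCurve_smul, hD, smul_smul, RingHom.id_apply]

end BanachAlgebra

theorem exp_apply_of_apply_eq_zero {E : Type*} [NormedAddCommGroup E] [NormedSpace ℝ E]
    [CompleteSpace E] {X : E →L[ℝ] E} {v : E} (h : X v = 0) : NormedSpace.exp X v = v := by
  have hg : ∀ s, HasDerivAt (fun t : ℝ => NormedSpace.exp (t • X) v) 0 s := by
    intro s
    have h1 := (hasDerivAt_exp_smul_const (𝕂 := ℝ) X s).clm_apply (hasDerivAt_const s v)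
    simpa [h] using h1
  have hc := is_const_of_deriv_eq_zero (fun s => (hg s).differentiableAt) (fun s => (hg s).deriv) 1 0
  simpa [NormedSpace.exp_zero] using hc

/-! ### Slices and embedded submanifolds. -/

section Slices

variable {P F E : Type*} [NormedAddCommGroup P] [NormedSpace ℝ P] [NormedAddCommGroup F]
  [NormedSpace ℝ F] [NormedAddCommGroup E] [NormedSpace ℝ E]

/-- `Ψ` is a smooth local parametrization of `E` by `P × F` in which `S` becomes `P × {0}`. -/
structure IsSliceParam (S : Set E) (Ψ : OpenPartialHomeomorph (P × F) E) : Prop where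
  contDiffOn : ContDiffOn ℝ ∞ Ψ Ψ.source
  contDiffOn_symm : ContDiffOn ℝ ∞ Ψ.symm Ψ.target
  mem_iff : ∀ p ∈ Ψ.source, Ψ p ∈ S ↔ p.2 = 0

namespace IsSliceParam

variable {S : Set E} {Ψ : OpenPartialHomeomorph (P × F) E}

theorem symm_snd (h : IsSliceParam S Ψ) {x : E} (hx : x ∈ S) (hxt : x ∈ Ψ.target) :
    (Ψ.symm x).2 = 0 :=
  (h.mem_iff _ (Ψ.map_target hxt)).1 (by rwa [Ψ.right_inv hxt])

theorem symm_eq (h : IsSliceParam S Ψ) {x : E} (hx : x ∈ S) (hxt : x ∈ Ψ.target) :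
    ((Ψ.symm x).1, (0 : F)) = Ψ.symm x :=
  Prod.ext rfl (h.symm_snd hx hxt).symm

open Classical in
/-- The chart of `S` given by a slice parametrization. -/
noncomputable def chart (h : IsSliceParam S Ψ) (x : S) : OpenPartialHomeomorph S P where
  toFun y := (Ψ.symm y).1
  -- The point `x` is only a default value outside the target.
  invFun u := if hu : (u, (0 : F)) ∈ Ψ.source then ⟨Ψ (u, 0), (h.mem_iff _ hu).2 rfl⟩ else x
  source := {y | (y : E) ∈ Ψ.target}
  target := {u | (u, (0 : F)) ∈ Ψ.source}
  map_source' y hy := by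
    change ((Ψ.symm y).1, (0 : F)) ∈ Ψ.source
    rw [h.symm_eq y.2 hy]
    exact Ψ.map_target hy
  map_target' u hu := by
    have hu : (u, (0 : F)) ∈ Ψ.source := hu
    rw [dif_pos hu]
    exact Ψ.map_source hu
  left_inv' y hy := by
    have h1 := h.symm_eq y.2 hy
    have hu : ((Ψ.symm y).1, (0 : F)) ∈ Ψ.source := by
      rw [h1]; exact Ψ.map_target hy
    rw [dif_pos hu]
    apply Subtype.ext
    change Ψ ((Ψ.symm y).1, (0 : F)) = y
    rw [h1, Ψ.right_inv hy]
  right_inv' u hu := by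
    have hu : (u, (0 : F)) ∈ Ψ.source := hu
    rw [dif_pos hu]
    change (Ψ.symm (Ψ (u, 0))).1 = u
    rw [Ψ.left_inv hu]
  open_source := Ψ.open_target.preimage continuous_subtype_val
  open_target := Ψ.open_source.preimage (Continuous.prodMk_left 0)
  continuousOn_toFun :=
    continuous_fst.comp_continuousOn (Ψ.continuousOn_symm.comp continuous_subtype_val.continuousOn
      fun _ hy => hy)
  continuousOn_invFun := by
    rw [IsEmbedding.subtypeVal.continuousOn_iff]
    have : ContinuousOn (fun u : P => Ψ (u, (0 : F))) {u | (u, (0 : F)) ∈ Ψ.source} :=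
      Ψ.continuousOn.comp (Continuous.prodMk_left 0).continuousOn fun _ hu => hu
    refine this.congr fun u hu => ?_
    have hu : (u, (0 : F)) ∈ Ψ.source := hu
    simp [hu]

theorem chart_apply (h : IsSliceParam S Ψ) (x y : S) : h.chart x y = (Ψ.symm y).1 := rfl

theorem mem_chart_source (h : IsSliceParam S Ψ) (x y : S) :
    y ∈ (h.chart x).source ↔ (y : E) ∈ Ψ.target := Iff.rfl

theorem mem_chart_target (h : IsSliceParam S Ψ) (x : S) (u : P) :
    u ∈ (h.chart x).target ↔ (u, (0 : F)) ∈ Ψ.source := Iff.rfl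

theorem chart_symm_apply (h : IsSliceParam S Ψ) (x : S) {u : P} (hu : u ∈ (h.chart x).target) :
    ((h.chart x).symm u : E) = Ψ (u, 0) := by
  have hu : (u, (0 : F)) ∈ Ψ.source := hu
  exact congrArg Subtype.val (dif_pos hu)

end IsSliceParam

/-- The transition map is `u ↦ (Ψ'.symm (Ψ (u, 0))).1`, a composite of smooth maps of the ambient
spaces. -/
theorem contDiffOn_chart_symm_trans_chart {S : Set E} {Ψ Ψ' : OpenPartialHomeomorph (P × F) E}
    (h : IsSliceParam S Ψ) (h' : IsSliceParam S Ψ') (x x' : S) :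
    ContDiffOn ℝ ∞ ((h.chart x).symm ≫ₕ h'.chart x') ((h.chart x).symm ≫ₕ h'.chart x').source := by
  have hmem : ∀ u ∈ ((h.chart x).symm ≫ₕ h'.chart x').source,
      (u, (0 : F)) ∈ Ψ.source ∧ Ψ (u, 0) ∈ Ψ'.target := by
    intro u hu
    rw [OpenPartialHomeomorph.trans_source] at hu
    refine ⟨hu.1, ?_⟩
    have := (h'.mem_chart_source x' _).1 hu.2
    rwa [h.chart_symm_apply x hu.1] at this
  have hs : ContDiffOn ℝ ∞ (fun u : P => (Ψ'.symm (Ψ (u, (0 : F)))).1)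
      ((h.chart x).symm ≫ₕ h'.chart x').source := by
    refine contDiff_fst.comp_contDiffOn ?_
    refine h'.contDiffOn_symm.comp (t := Ψ'.target) ?_ fun u hu => (hmem u hu).2
    exact h.contDiffOn.comp (t := Ψ.source)
      (contDiff_id.prodMk contDiff_const).contDiffOn fun u hu => (hmem u hu).1
  refine hs.congr fun u hu => ?_
  rw [OpenPartialHomeomorph.coe_trans, Function.comp_apply, h'.chart_apply,
    h.chart_symm_apply x (hmem u hu).1]

/-- A set that is a slice near each of its points is an embedded submanifold. -/
theorem isEmbeddedSubmanifold_of_slices {r : ℕ} {S : Set E}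
    (e : (EuclideanSpace ℝ (Fin r) × F) ≃L[ℝ] E)
    (h : ∀ x ∈ S, ∃ Ψ : OpenPartialHomeomorph (EuclideanSpace ℝ (Fin r) × F) E,
      x ∈ Ψ.target ∧ IsSliceParam S Ψ) : IsEmbeddedSubmanifold r S := by
  choose Ψ hx hΨ using fun x : S => h x x.2
  let cs : ChartedSpace (EuclideanSpace ℝ (Fin r)) S :=
    { atlas := Set.range fun x => (hΨ x).chart x
      chartAt := fun x => (hΨ x).chart x
      mem_chart_source := fun x => hx x
      chart_mem_atlas := fun x => ⟨x, rfl⟩ }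
  have hM : IsManifold (𝓡 r) ∞ S := by
    refine isManifold_of_contDiffOn _ _ _ ?_
    rintro _ _ ⟨x, rfl⟩ ⟨x', rfl⟩
    simpa using contDiffOn_chart_symm_trans_chart (hΨ x) (hΨ x') x x'
  refine ⟨cs, hM, ?_, IsEmbedding.subtypeVal⟩
  refine Manifold.IsImmersionOfComplement.isImmersion (F := F) fun x => ?_
  -- A chart of `E` must take values in `E`, so `Ψ.symm` is followed by `e`. In these charts the
  -- inclusion reads `u ↦ e (u, 0)`.
  refine Manifold.IsImmersionAtOfComplement.mk_of_charts e ((hΨ x).chart x)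
    ((Ψ x).symm ≫ₕ e.toHomeomorph.toOpenPartialHomeomorph) (hx x) (by simpa using hx x)
    (IsManifold.chart_mem_maximalAtlas x) ?_ ?_ ?_
  · apply OpenPartialHomeomorph.mem_maximalAtlas_of_contMDiffOn
    · rw [contMDiffOn_iff_contDiffOn]
      refine (e.contDiff.comp_contDiffOn ((hΨ x).contDiffOn_symm)).congr_mono
        (fun y _ => rfl) fun y hy => ?_
      simpa using hy
    · rw [contMDiffOn_iff_contDiffOn]
      refine ((hΨ x).contDiffOn.comp (s := e.symm ⁻¹' (Ψ x).source)
        e.symm.contDiff.contDiffOn fun y hy => hy).congr_mono (fun y _ => rfl) fun y hy => ?_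
      simpa using hy
  · intro y hy
    simpa using ((hΨ x).mem_chart_source x y).1 hy
  · intro u hu
    have hu : u ∈ ((hΨ x).chart x).target := by simpa using hu
    have h1 := (hΨ x).chart_symm_apply x hu
    have h2 := (Ψ x).left_inv (((hΨ x).mem_chart_target x u).1 hu)
    simp [h1, h2]

end Slices

/-! ### Factoring group elements near the identity. -/

/-- The map `(u, y, w) ↦ exp (a u) exp (b y) exp (c w)` is open at `0` if the ranges of the linear
maps `a`, `b` and `c` span the algebra. -/
theorem setOf_exp_mul_exp_mul_exp_mem_nhds {R P Q C : Type*} [NormedRing R] [NormedAlgebra ℝ R]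
    [CompleteSpace R] [NormedAddCommGroup P] [NormedSpace ℝ P] [FiniteDimensional ℝ P]
    [NormedAddCommGroup Q] [NormedSpace ℝ Q] [FiniteDimensional ℝ Q]
    [NormedAddCommGroup C] [NormedSpace ℝ C] [FiniteDimensional ℝ C]
    (a : P →ₗ[ℝ] R) (b : Q →ₗ[ℝ] R) (c : C →ₗ[ℝ] R)
    (h : ∀ x, ∃ u y w, a u + b y + c w = x) {U : Set P} (hU : U ∈ 𝓝 0) {W : Set C} (hW : W ∈ 𝓝 0) :
    {x | ∃ u ∈ U, ∃ y, ∃ w ∈ W,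
      NormedSpace.exp (a u) * NormedSpace.exp (b y) * NormedSpace.exp (c w) = x} ∈ 𝓝 (1 : R) := by
  have := FiniteDimensional.complete ℝ P
  have := FiniteDimensional.complete ℝ Q
  have := FiniteDimensional.complete ℝ C
  let a' : P × Q × C →L[ℝ] R := a.toContinuousLinearMap ∘L .fst ℝ P (Q × C)
  let b' : P × Q × C →L[ℝ] R := b.toContinuousLinearMap ∘L .fst ℝ Q C ∘L .snd ℝ P (Q × C)
  let c' : P × Q × C →L[ℝ] R := c.toContinuousLinearMap ∘L .snd ℝ Q C ∘L .snd ℝ P (Q × C)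
  let Φ : P × Q × C → R := fun x =>
    NormedSpace.exp (a' x) * NormedSpace.exp (b' x) * NormedSpace.exp (c' x)
  have hexp : ∀ l : P × Q × C →L[ℝ] R,
      HasStrictFDerivAt (fun x => NormedSpace.exp (l x)) l 0 := by
    intro l
    have h := hasStrictFDerivAt_exp_zero (𝕂 := ℝ) (𝔸 := R)
    rw [← map_zero l] at h
    exact h.comp (0 : P × Q × C) l.hasStrictFDerivAt
  have hΦ : HasStrictFDerivAt Φ (a' + b' + c') 0 := by
    refine (((hexp a').mul' (hexp b')).mul' (hexp c')).congr_fderiv ?_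
    refine ContinuousLinearMap.ext fun x => ?_
    simp [NormedSpace.exp_zero]
    abel
  have hsurj : (a' + b' + c').range = ⊤ := by
    rw [LinearMap.range_eq_top]
    intro x
    obtain ⟨u, y, w, hx⟩ := h x
    exact ⟨(u, y, w), hx⟩
  -- A surjective strict derivative already makes `Φ` open at `0`; the sum of the three ranges need
  -- not be direct.
  have hmap := hΦ.map_nhds_eq_of_surj hsurj
  have hΦ0 : Φ 0 = 1 := by simp [Φ, NormedSpace.exp_zero]
  rw [hΦ0] at hmap
  have hset : {x : P × Q × C | x.1 ∈ U ∧ x.2.2 ∈ W} ∈ 𝓝 0 :=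
    inter_mem (continuous_fst.tendsto' (0 : P × Q × C) 0 rfl hU)
      (continuous_snd.snd.tendsto' (0 : P × Q × C) 0 rfl hW)
  have himg := image_mem_map (m := Φ) hset
  rw [hmap] at himg
  filter_upwards [himg]
  rintro _ ⟨⟨u, y, w⟩, ⟨hu, hw⟩, rfl⟩
  exact ⟨u, hu, y, w, hw, rfl⟩

section ClosedSubgroup

open scoped Matrix.Norms.Operator

variable {d : ℕ} {G : Subgroup (GL (Fin d) ℂ)} {hG : IsClosed (G : Set (GL (Fin d) ℂ))}

theorem expGL_neg (A : Matrix (Fin d) (Fin d) ℂ) : expGL (-A) = (expGL A)⁻¹ := by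
  ext1
  rfl

/-- If `exp (c k • u k) ∈ G` with `c k → 0`, then any limit of the `u k` is in the Lie algebra. -/
theorem mem_lieAlgebra_of_tendsto {u : ℕ → Matrix (Fin d) (Fin d) ℂ} {c : ℕ → ℝ}
    {A : Matrix (Fin d) (Fin d) ℂ} (hc : Tendsto c atTop (𝓝 0)) (hpos : ∀ k, 0 < c k)
    (hu : Tendsto u atTop (𝓝 A)) (hmem : ∀ k, expGL (c k • u k) ∈ G) : A ∈ lieAlgebra G hG := by
  have key : ∀ t : ℝ, 0 ≤ t → expGL (t • A) ∈ G := by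
    intro t ht
    -- `exp (tA)` is the limit of the powers `exp (c k • u k) ^ ⌊t / c k⌋₊`, which lie in the closed
    -- group `G`.
    have h1 : Tendsto (fun k => (⌊t / c k⌋₊ : ℝ) * c k) atTop (𝓝 t) := by
      have h2 : ∀ k, t - c k ≤ (⌊t / c k⌋₊ : ℝ) * c k := by
        intro k
        have := (Nat.lt_floor_add_one (t / c k)).le
        rw [div_le_iff₀ (hpos k)] at this
        linarith
      have h3 : ∀ k, (⌊t / c k⌋₊ : ℝ) * c k ≤ t := by
        intro k
        have := Nat.floor_le (div_nonneg ht (hpos k).le)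
        rwa [le_div_iff₀ (hpos k)] at this
      refine tendsto_of_tendsto_of_tendsto_of_le_of_le ?_ tendsto_const_nhds h2 h3
      simpa using tendsto_const_nhds.sub hc
    have h2 := (continuous_expGL.tendsto _).comp (h1.smul hu)
    refine hG.mem_of_tendsto h2 (Eventually.of_forall fun k => ?_)
    rw [Function.comp_apply, mul_smul, expGL_nsmul]
    exact G.pow_mem (hmem k) _
  intro t
  rcases le_total 0 t with ht | ht
  · exact key t ht
  · have := G.inv_mem (key (-t) (neg_nonneg.2 ht))
    rwa [neg_smul, expGL_neg, inv_inv] at this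

/-- Close to `0`, the exponential maps no nonzero element of a complement of the Lie algebra
into the group. -/
theorem eventually_eq_zero_of_expGL_mem {C : Type*} [NormedAddCommGroup C] [NormedSpace ℝ C]
    [FiniteDimensional ℝ C] (c : C →ₗ[ℝ] Matrix (Fin d) (Fin d) ℂ)
    (hC : ∀ w, c w ∈ lieAlgebra G hG → w = 0) :
    ∀ᶠ w in 𝓝 0, expGL (c w) ∈ G → w = 0 := by
  by_contra hcon
  have hne : ∃ᶠ w in 𝓝 0, expGL (c w) ∈ G ∧ w ≠ 0 := by
    refine fun h => hcon (h.mono fun w hw hG' => ?_)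
    by_contra h0
    exact hw ⟨hG', h0⟩
  obtain ⟨w, hw, hwG⟩ := exists_seq_forall_of_frequently hne
  have hn : ∀ k, 0 < ‖w k‖ := fun k => norm_pos_iff.2 (hwG k).2
  -- A limit of normalized counterexamples is a unit vector that `c` maps into the Lie algebra,
  -- contradicting `hC`.
  let u : ℕ → C := fun k => ‖w k‖⁻¹ • w k
  have hu : ∀ k, u k ∈ Metric.sphere (0 : C) 1 := by
    intro k
    rw [mem_sphere_zero_iff_norm, norm_smul, norm_inv, norm_norm, inv_mul_cancel₀ (hn k).ne']
  have := FiniteDimensional.proper ℝ C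
  obtain ⟨A, hA, θ, hθ, hlim⟩ := (isCompact_sphere (0 : C) 1).tendsto_subseq hu
  have hmem : c A ∈ lieAlgebra G hG := by
    refine mem_lieAlgebra_of_tendsto (c := fun k => ‖w (θ k)‖)
      ?_ (fun k => hn _) ((c.continuous_of_finiteDimensional.tendsto _).comp hlim) fun k => ?_
    · have := (continuous_norm.tendsto (0 : C)).comp (hw.comp hθ.tendsto_atTop)
      rwa [norm_zero] at this
    · have : ‖w (θ k)‖ • c (u (θ k)) = c (w (θ k)) := by
        rw [← map_smul, smul_smul, mul_inv_cancel₀ (hn _).ne', one_smul]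
      simp only [Function.comp_apply]
      rw [this]
      exact (hwG _).1
  rw [hC A hmem] at hA
  simp at hA

/-- Near `1` every invertible matrix is `exp (j u) exp (b y) exp (c w)` with `w` small. If the
product is in `G`, so is the last factor, and then `w = 0`. -/
theorem eventually_exists_eq_expCurve_mul_of_span {P Q C : Type*}
    [NormedAddCommGroup P] [NormedSpace ℝ P] [FiniteDimensional ℝ P]
    [NormedAddCommGroup Q] [NormedSpace ℝ Q] [FiniteDimensional ℝ Q]
    [NormedAddCommGroup C] [NormedSpace ℝ C] [FiniteDimensional ℝ C]
    (j : P →ₗ[ℝ] lieAlgebra G hG) (b : Q →ₗ[ℝ] lieAlgebra G hG)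
    (c : C →ₗ[ℝ] Matrix (Fin d) (Fin d) ℂ) (hc : ∀ w, c w ∈ lieAlgebra G hG → w = 0)
    (hspan : ∀ x : Matrix (Fin d) (Fin d) ℂ, ∃ u y w, (j u).val + (b y).val + c w = x)
    {U : Set P} (hU : U ∈ 𝓝 0) :
    ∀ᶠ g : G in 𝓝 1, ∃ u ∈ U, ∃ y, g = expCurve (j u) 1 * expCurve (b y) 1 := by
  have hW := eventually_eq_zero_of_expGL_mem (G := G) (hG := hG) c hc
  have himg := setOf_exp_mul_exp_mul_exp_mem_nhds ((lieAlgebra G hG).subtype ∘ₗ j)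
    ((lieAlgebra G hG).subtype ∘ₗ b) c hspan hU hW
  have hval : Tendsto (fun g : G => (g : GL (Fin d) ℂ).val) (𝓝 1) (𝓝 1) :=
    (Units.continuous_val.comp continuous_subtype_val).tendsto' _ _ rfl
  filter_upwards [hval himg] with g hg
  obtain ⟨u, hu, y, w, hw, hgx⟩ := hg
  have hg' : (g : GL (Fin d) ℂ) =
      (expCurve (j u) 1 : G) * (expCurve (b y) 1 : G) * expGL (c w) := by
    ext1
    simp only [expCurve, one_smul]
    exact hgx.symm
  have hwG : expGL (c w) ∈ G := by
    have : expGL (c w) = ((expCurve (j u) 1 * expCurve (b y) 1 : G)⁻¹ * g : G) := by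
      rw [Subgroup.coe_mul, hg']
      simp [mul_assoc]
    rw [this]
    exact Subtype.property _
  refine ⟨u, hu, y, Subtype.ext ?_⟩
  rw [hg', hw hwG, map_zero, expGL_zero, mul_one]
  rfl

end ClosedSubgroup

/-- Parametrizing by a Euclidean space supplies a norm to subspaces of the matrices and of the Lie
algebra, on which none is fixed. -/
theorem Submodule.exists_linearMap_injective_range_eq {E : Type*} [AddCommGroup E] [Module ℝ E]
    [FiniteDimensional ℝ E] (q : Submodule ℝ E) :
    ∃ (n : ℕ) (b : EuclideanSpace ℝ (Fin n) →ₗ[ℝ] E), Function.Injective b ∧ b.range = q := by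
  let e : EuclideanSpace ℝ (Fin (Module.finrank ℝ q)) ≃ₗ[ℝ] q :=
    LinearEquiv.ofFinrankEq _ _ (by simp)
  exact ⟨_, q.subtype ∘ₗ e.toLinearMap, q.subtype_injective.comp e.injective, by simp⟩

/-- If the range of `j` and the subspace `q` span the Lie algebra, then near `1` every element of
the group is `exp (j u) exp Y` with `u` small and `Y ∈ q`. -/
theorem eventually_exists_eq_expCurve_mul {d : ℕ} {G : Subgroup (GL (Fin d) ℂ)}
    {hG : IsClosed (G : Set (GL (Fin d) ℂ))} {P : Type*} [NormedAddCommGroup P] [NormedSpace ℝ P]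
    [FiniteDimensional ℝ P] (j : P →ₗ[ℝ] lieAlgebra G hG) (q : Submodule ℝ (lieAlgebra G hG))
    (hjq : j.range ⊔ q = ⊤) {U : Set P} (hU : U ∈ 𝓝 0) :
    ∀ᶠ g : G in 𝓝 1, ∃ u ∈ U, ∃ Y ∈ q, g = expCurve (j u) 1 * expCurve Y 1 := by
  obtain ⟨C, hC⟩ := Submodule.exists_isCompl (lieAlgebra G hG)
  obtain ⟨m, b, -, rfl⟩ := q.exists_linearMap_injective_range_eq
  obtain ⟨n, c, hc, rfl⟩ := C.exists_linearMap_injective_range_eq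
  refine (eventually_exists_eq_expCurve_mul_of_span j b c (fun w hw => ?_) (fun x => ?_) hU).mono ?_
  · exact (map_eq_zero_iff c hc).1 (Submodule.disjoint_def.1 hC.disjoint _ hw ⟨w, rfl⟩)
  · obtain ⟨A, hA, _, ⟨w, rfl⟩, rfl⟩ :=
      Submodule.mem_sup.1 (hC.sup_eq_top.ge (Submodule.mem_top (x := x)))
    obtain ⟨_, ⟨u, rfl⟩, _, ⟨y, rfl⟩, h⟩ :=
      Submodule.mem_sup.1 (hjq.ge (Submodule.mem_top (x := (⟨A, hA⟩ : lieAlgebra G hG))))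
    exact ⟨u, y, w, congrArg (· + c w) (congrArg Subtype.val h)⟩
  · rintro g ⟨u, hu, y, h⟩
    exact ⟨u, hu, b y, ⟨y, rfl⟩, h⟩

/-! ### Constructing and transporting slices. -/

section Slices

variable {P F E : Type*} [NormedAddCommGroup P] [NormedSpace ℝ P] [NormedAddCommGroup F]
  [NormedSpace ℝ F] [NormedAddCommGroup E] [NormedSpace ℝ E]

/-- An analytic local parametrization of `E` by `P × F` is a slice parametrization of `S` if the
points of `S` near the base point are the values at small points of `P × {0}`. -/
theorem exists_isSliceParam [CompleteSpace P] [CompleteSpace F] [CompleteSpace E]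
    {S : Set E} {f : P × F → E} {e : (P × F) ≃L[ℝ] E} (hf : ContDiff ℝ ω f)
    (hf' : HasFDerivAt f (e : (P × F) →L[ℝ] E) 0) (hS : ∀ u, f (u, 0) ∈ S)
    (hS' : ∀ U ∈ 𝓝 (0 : P), ∀ᶠ w in 𝓝 (f 0), w ∈ S → ∃ u ∈ U, f (u, 0) = w) :
    ∃ Ψ : OpenPartialHomeomorph (P × F) E, f 0 ∈ Ψ.target ∧ IsSliceParam S Ψ := by
  have hω : (ω : WithTop ℕ∞) ≠ 0 := by simp
  let Φ := hf.contDiffAt.toOpenPartialHomeomorph f hf' hω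
  have h0 : (0 : P × F) ∈ Φ.source :=
    hf.contDiffAt.mem_toOpenPartialHomeomorph_source hf' hω
  -- Regularity `ω` at a point persists nearby. With `∞` the neighbourhood could shrink as the order
  -- of differentiability grows.
  have hsymm : ∀ᶠ y in 𝓝 (f 0), ContDiffAt ℝ ω Φ.symm y :=
    (hf.contDiffAt.to_localInverse hf' hω).eventually (by simp)
  have hU : {u : P | (u, (0 : F)) ∈ Φ.source} ∈ 𝓝 0 :=
    (Continuous.prodMk_left (0 : F)).tendsto' (0 : P) 0 rfl (Φ.open_source.mem_nhds h0)
  obtain ⟨A, hA, hAo, hA0⟩ := mem_nhds_iff.1 (hsymm.and (hS' _ hU))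
  let Ψ := Φ.restrOpen (f ⁻¹' A) (hAo.preimage hf.continuous)
  have hsrc : Ψ.source = Φ.source ∩ f ⁻¹' A := Φ.restrOpen_source _ _
  have hcoe : ∀ p, Ψ p = f p := fun p => rfl
  have htgt : ∀ y ∈ Ψ.target, y ∈ A := by
    intro y hy
    have h1 : Ψ.symm y ∈ f ⁻¹' A := (hsrc ▸ Ψ.map_target hy : Ψ.symm y ∈ Φ.source ∩ f ⁻¹' A).2
    have h2 : f (Ψ.symm y) = y := Ψ.right_inv hy
    rwa [Set.mem_preimage, h2] at h1
  refine ⟨Ψ, ?_, ?_, ?_, ?_⟩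
  · have h1 : (0 : P × F) ∈ Ψ.source := by rw [hsrc]; exact ⟨h0, hA0⟩
    exact Ψ.map_source h1
  · exact (hf.of_le le_top).contDiffOn
  · intro y hy
    exact ((hA (htgt y hy)).1.of_le le_top).contDiffWithinAt
  · intro p hp
    rw [hsrc] at hp
    rw [hcoe]
    constructor
    -- `f p` is also some `f (u, 0)` with `(u, 0)` in the source, so injectivity gives `p = (u, 0)`.
    · intro hpS
      obtain ⟨u, hu, hup⟩ := (hA hp.2).2 hpS
      rw [← Φ.injOn hu hp.1 hup]
    · intro hp0
      rw [show p = (p.1, 0) from Prod.ext rfl hp0]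
      exact hS _

/-- Reduces an orbit to a single base point: the group acts by such `T`. -/
theorem IsSliceParam.transHomeomorph {S : Set E} {Ψ : OpenPartialHomeomorph (P × F) E}
    (h : IsSliceParam S Ψ) (T : E ≃L[ℝ] E) (hT : ∀ y, T y ∈ S ↔ y ∈ S) :
    IsSliceParam S (Ψ.transHomeomorph T.toHomeomorph) where
  contDiffOn := T.contDiff.comp_contDiffOn h.contDiffOn
  contDiffOn_symm := h.contDiffOn_symm.comp T.symm.contDiff.contDiffOn fun _ hy => hy
  mem_iff p hp := (hT _).trans (h.mem_iff p hp)

end Slices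

/-! ### Orbits of compact matrix groups. -/

section Orbit

variable {E : Type*} [NormedAddCommGroup E] [NormedSpace ℝ E]

/-- Near `v`, the orbit of `v` under a compact group consists of the translates of `v` by group
elements near `1`. -/
theorem eventually_exists_mem_nhds_apply_eq {Γ : Type*} [Group Γ] [TopologicalSpace Γ]
    [ContinuousMul Γ] [CompactSpace Γ] {ρ : Γ →* (E →L[ℝ] E)} (hρ : Continuous ρ) (v : E)
    {N : Set Γ} (hN : N ∈ 𝓝 1) :
    ∀ᶠ w in 𝓝 v, (∃ g, ρ g v = w) → ∃ g ∈ N, ρ g v = w := by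
  obtain ⟨O, hON, hO, h1⟩ := mem_nhds_iff.1 hN
  -- `K` consists of the `g` that no stabilizer element can move into `O`. It is compact and its
  -- orbit image misses `v`: if `g v = v`, then `h = g⁻¹` gives `g * h = 1 ∈ O`.
  let K : Set Γ := {g | ∀ h, ρ h v = v → g * h ∉ O}
  have hK : IsClosed K := by
    simp only [K, Set.ofPred_forall]
    exact isClosed_iInter fun h => isClosed_iInter fun _ =>
      hO.isClosed_compl.preimage (continuous_mul_const h)
  have hcont : Continuous fun g => ρ g v := hρ.clm_apply continuous_const
  have himg : IsClosed ((fun g => ρ g v) '' K) := (hK.isCompact.image hcont).isClosed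
  have hv : v ∉ (fun g => ρ g v) '' K := by
    rintro ⟨g, hg, hgv⟩
    refine hg g⁻¹ ?_ (by rwa [mul_inv_cancel])
    calc ρ g⁻¹ v = ρ g⁻¹ (ρ g v) := by rw [show ρ g v = v from hgv]
      _ = (ρ g⁻¹ * ρ g) v := rfl
      _ = v := by rw [← map_mul, inv_mul_cancel, map_one]; rfl
  filter_upwards [himg.isOpen_compl.mem_nhds hv]
  rintro _ hw ⟨g, rfl⟩
  have hgK : g ∉ K := fun h => hw ⟨g, h, rfl⟩
  simp only [K, Set.mem_ofPred_eq, not_forall, not_not] at hgK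
  obtain ⟨h, hh, hgh⟩ := hgK
  exact ⟨g * h, hON hgh, by rw [map_mul]; exact congrArg (ρ g) hh⟩

variable [FiniteDimensional ℝ E] {d : ℕ} {G : Subgroup (GL (Fin d) ℂ)}
  {hG : IsClosed (G : Set (GL (Fin d) ℂ))}

/-- The orbits of a continuous finite-dimensional representation of a compact matrix Lie group
are embedded submanifolds. -/
theorem isEmbeddedSubmanifold_orbit [CompactSpace G] {ρ : G →* (E →L[ℝ] E)} (hρ : Continuous ρ)
    {D : lieAlgebra G hG →ₗ[ℝ] (E →L[ℝ] E)}
    (hD : ∀ A t, ρ (expCurve A t) = NormedSpace.exp (t • D A)) (v : E)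
    {L : lieAlgebra G hG →ₗ[ℝ] E} (hL : ∀ A, L A = D A v) :
    IsEmbeddedSubmanifold (Module.finrank ℝ L.range) {w | ∃ g, ρ g v = w} := by
  have := FiniteDimensional.complete ℝ E
  set S : Set E := {w | ∃ g, ρ g v = w}
  obtain ⟨s, hs⟩ := L.rangeRestrict.exists_rightInverse_of_surjective L.range_rangeRestrict
  obtain ⟨C, hC⟩ := Submodule.exists_isCompl L.range
  let l : EuclideanSpace ℝ (Fin (Module.finrank ℝ L.range)) ≃ₗ[ℝ] L.range :=
    LinearEquiv.ofFinrankEq _ _ (by simp)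
  let j : EuclideanSpace ℝ (Fin (Module.finrank ℝ L.range)) →ₗ[ℝ] lieAlgebra G hG :=
    s ∘ₗ l.toLinearMap
  have hLs : ∀ y, L (s y) = y := fun y => congrArg Subtype.val (LinearMap.congr_fun hs y)
  have hLj : ∀ u, D (j u) v = l u := fun u => by rw [← hL]; exact hLs _
  let e : (EuclideanSpace ℝ (Fin (Module.finrank ℝ L.range)) × C) ≃L[ℝ] E :=
    ((l.prodCongr (LinearEquiv.refl ℝ C)).trans
      (Submodule.prodEquivOfIsCompl _ _ hC)).toContinuousLinearEquiv
  have he : ∀ p, e p = l p.1 + p.2 := fun p => rfl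
  -- Each `A` is `s (L A)` plus an element killed by `L`.
  have hspan : j.range ⊔ LinearMap.ker L = ⊤ := by
    refine eq_top_iff.2 fun A _ => Submodule.mem_sup.2
      ⟨s (L.rangeRestrict A), ⟨l.symm (L.rangeRestrict A), by simp [j]⟩,
        A - s (L.rangeRestrict A), ?_, by simp⟩
    rw [LinearMap.mem_ker, map_sub, hLs]
    exact sub_self _
  let f : EuclideanSpace ℝ (Fin (Module.finrank ℝ L.range)) × C → E :=
    fun p => NormedSpace.exp (D (j p.1)) v + p.2
  have hexp : ∀ A, NormedSpace.exp (D A) = ρ (expCurve A 1) := fun A => by rw [hD, one_smul]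
  have hf0 : f 0 = v := by simp [f, NormedSpace.exp_zero]
  let a : EuclideanSpace ℝ (Fin (Module.finrank ℝ L.range)) × C →L[ℝ] (E →L[ℝ] E) :=
    (D ∘ₗ j).toContinuousLinearMap ∘L .fst ℝ _ _
  let c : EuclideanSpace ℝ (Fin (Module.finrank ℝ L.range)) × C →L[ℝ] E :=
    C.subtypeL ∘L .snd ℝ _ _
  have hf : ContDiff ℝ ω f := by
    have h1 : ContDiff ℝ ω (NormedSpace.exp : (E →L[ℝ] E) → _) :=
      contDiff_iff_contDiffAt.2 fun x => (NormedSpace.exp_analytic x).contDiffAt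
    exact ((h1.comp a.contDiff).clm_apply contDiff_const).add c.contDiff
  have hf' : HasFDerivAt f (e : EuclideanSpace ℝ (Fin (Module.finrank ℝ L.range)) × C →L[ℝ] E)
      0 := by
    have h1 : HasFDerivAt (NormedSpace.exp : (E →L[ℝ] E) → _) (1 : (E →L[ℝ] E) →L[ℝ] _) (a 0) := by
      rw [map_zero]; exact hasFDerivAt_exp_zero
    have h2 := ((h1.comp 0 a.hasFDerivAt).clm_apply (hasFDerivAt_const v 0)).add c.hasFDerivAt
    refine h2.congr_fderiv (ContinuousLinearMap.ext fun p => ?_)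
    simp [a, c, he, hLj]
  have hS : ∀ u, f (u, 0) ∈ S := fun u => ⟨expCurve (j u) 1, by simp [f, hexp]⟩
  have hS' : ∀ U ∈ 𝓝 (0 : EuclideanSpace ℝ (Fin (Module.finrank ℝ L.range))),
      ∀ᶠ w in 𝓝 (f 0), w ∈ S → ∃ u ∈ U, f (u, 0) = w := by
    intro U hU
    rw [hf0]
    refine (eventually_exists_mem_nhds_apply_eq hρ v
      (eventually_exists_eq_expCurve_mul j _ hspan hU)).mono fun w hw hwS => ?_
    obtain ⟨_, ⟨u, hu, Y, hY, rfl⟩, rfl⟩ := hw hwS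
    refine ⟨u, hu, ?_⟩
    have hYv : ρ (expCurve Y 1) v = v := by
      rw [← hexp]
      exact exp_apply_of_apply_eq_zero ((hL Y).symm.trans hY)
    have hmul : ρ (expCurve (j u) 1 * expCurve Y 1) v = ρ (expCurve (j u) 1) v := by
      rw [map_mul]
      exact congrArg _ hYv
    rw [hmul]
    simp [f, hexp]
  obtain ⟨Ψ, hΨv, hΨ⟩ := exists_isSliceParam hf hf' hS hS'
  rw [hf0] at hΨv
  refine isEmbeddedSubmanifold_of_slices e ?_
  rintro _ ⟨g, rfl⟩
  have hinv : ∀ (h : G) (y : E), ρ h⁻¹ (ρ h y) = y := fun h y => by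
    change (ρ h⁻¹ * ρ h) y = y
    rw [← map_mul, inv_mul_cancel, map_one]
    rfl
  have hmem : ∀ (h : G) (y : E), y ∈ S → ρ h y ∈ S := by
    rintro h _ ⟨k, rfl⟩
    exact ⟨h * k, by rw [map_mul]; rfl⟩
  -- `T = ρ g` preserves the orbit and takes `v` to `ρ g v`, so it carries the slice at `v` there.
  let T : E ≃L[ℝ] E := ContinuousLinearEquiv.equivOfInverse (ρ g) (ρ g⁻¹) (hinv g)
    (fun y => by simpa using hinv g⁻¹ y)
  refine ⟨_, ?_, hΨ.transHomeomorph T fun y => ⟨fun h => ?_, hmem g y⟩⟩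
  · change T.symm (ρ g v) ∈ Ψ.target
    have : T.symm (ρ g v) = v := hinv g v
    rwa [this]
  · have := hmem g⁻¹ _ h
    rwa [show ρ g⁻¹ (T y) = y from hinv g y] at this

end Orbit

/-! ### Differentials of unitary representations. -/

section UnitaryRep

variable {d : ℕ} {G : Subgroup (GL (Fin d) ℂ)} {hG : IsClosed (G : Set (GL (Fin d) ℂ))}

theorem expCurve_injective {A B : lieAlgebra G hG} (h : ∀ t, expCurve A t = expCurve B t) :
    A = B := by
  open scoped Matrix.Norms.Operator in
  exact Subtype.ext (eq_of_forall_exp_smul_eq fun t =>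
    congrArg (fun g : G => (g : GL (Fin d) ℂ).val) (h t))

variable {R : Type*} [NormedRing R] [StarRing R] [NormedAlgebra ℝ R] [CompleteSpace R]

theorem exists_linearMap_eq_repDeriv {φ : G →* unitary R} (hφ : Continuous φ) :
    ∃ D : lieAlgebra G hG →ₗ[ℝ] R, (∀ A, repDeriv φ A = D A) ∧
      ∀ A t, (φ (expCurve A t) : R) = NormedSpace.exp (t • D A) := by
  obtain ⟨D, hD⟩ := exists_differential (hG := hG) (ρ := (unitary R).subtype.comp φ)
    (continuous_subtype_val.comp hφ)
  refine ⟨D, fun A => ?_, hD⟩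
  have h : (fun t : ℝ => (φ (expCurve A t) : R)) = fun t : ℝ => NormedSpace.exp (t • D A) :=
    funext (hD A)
  rw [repDeriv, h]
  exact (hasDerivAt_exp_smul_zero (D A)).deriv

theorem hasDerivAt_repDeriv {φ : G →* unitary R} (hφ : Continuous φ) (A : lieAlgebra G hG) :
    HasDerivAt (fun t : ℝ => (φ (expCurve A t) : R)) (repDeriv φ A) 0 := by
  obtain ⟨D, hD, hexp⟩ := exists_linearMap_eq_repDeriv (hG := hG) hφ
  rw [hD, show (fun t : ℝ => (φ (expCurve A t) : R)) = fun t : ℝ => NormedSpace.exp (t • D A) from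
    funext (hexp A)]
  exact hasDerivAt_exp_smul_zero (D A)

theorem isLinearMap_repDeriv {φ : G →* unitary R} (hφ : Continuous φ) :
    IsLinearMap ℝ (repDeriv φ : lieAlgebra G hG → R) := by
  obtain ⟨D, hD, -⟩ := exists_linearMap_eq_repDeriv (hG := hG) hφ
  rw [show (repDeriv φ : lieAlgebra G hG → R) = D from funext hD]
  exact D.isLinear

theorem repDeriv_injective {φ : G →* unitary R} (hφ : Continuous φ)
    (hinj : Function.Injective φ) : Function.Injective (repDeriv φ : lieAlgebra G hG → R) := by
  obtain ⟨D, hD, hexp⟩ := exists_linearMap_eq_repDeriv (hG := hG) hφ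
  intro A B h
  rw [hD, hD] at h
  exact expCurve_injective fun t => hinj (Subtype.ext (by rw [hexp, hexp, h]))

/-- The adjoint of the unitary `exp (tX)` is its inverse, so `exp (t X*) = exp (-tX)` for all `t`;
comparing generators gives `X* = -X`. -/
theorem repDeriv_mem_skewAdjoint [ContinuousStar R] [StarModule ℝ R] {φ : G →* unitary R}
    (hφ : Continuous φ) (A : lieAlgebra G hG) : repDeriv φ A ∈ skewAdjoint R := by
  obtain ⟨D, hD, hexp⟩ := exists_linearMap_eq_repDeriv (hG := hG) hφ
  rw [hD, skewAdjoint.mem_iff]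
  refine eq_of_forall_exp_smul_eq fun t => ?_
  let +nondep : NormedAlgebra ℚ R := .restrictScalars ℚ ℝ R
  have h1 : φ (expCurve A (-t)) = (φ (expCurve A t))⁻¹ := by
    rw [eq_inv_iff_mul_eq_one, ← map_mul, ← expCurve_add, neg_add_cancel, expCurve_zero, map_one]
  calc NormedSpace.exp (t • star (D A)) = star (NormedSpace.exp (t • D A)) := by
        rw [NormedSpace.star_exp, star_smul, star_trivial t]
    _ = (φ (expCurve A (-t)) : R) := by rw [h1, ← hexp]; rfl
    _ = _ := by rw [hexp, neg_smul, smul_neg]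

end UnitaryRep

/-! ### Orbits of unitary and orthogonal representations. -/

section Orbit

variable {d : ℕ} {G : Subgroup (GL (Fin d) ℂ)} {hG : IsClosed (G : Set (GL (Fin d) ℂ))}

theorem isCompact_repOrbit {𝕜 V Γ : Type*} [RCLike 𝕜] [NormedAddCommGroup V]
    [InnerProductSpace 𝕜 V] [CompleteSpace V] [Group Γ] [TopologicalSpace Γ] [CompactSpace Γ]
    {φ : Γ →* unitary (V →L[𝕜] V)} (hφ : Continuous φ) (v : V) : IsCompact (repOrbit φ v) :=
  isCompact_range ((continuous_subtype_val.comp hφ).clm_apply continuous_const)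

theorem Submodule.span_range_basis_image {ι M N : Type*} [AddCommGroup M] [Module ℝ M]
    [AddCommGroup N] [Module ℝ N] (L : M →ₗ[ℝ] N) (H : Module.Basis ι ℝ M) :
    Submodule.span ℝ (Set.range fun i => L (H i)) = L.range := by
  rw [LinearMap.range_eq_map, ← H.span_eq, Submodule.map_span, ← Set.range_comp]
  rfl

theorem exists_isEmbeddedSubmanifold_repOrbit_real [CompactSpace G] {V : Type*}
    [NormedAddCommGroup V] [InnerProductSpace ℝ V] [CompleteSpace V] [FiniteDimensional ℝ V]
    {φ : G →* unitary (V →L[ℝ] V)} (hφ : Continuous φ) (v : V) :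
    ∃ r : ℕ, IsEmbeddedSubmanifold r (repOrbit φ v) ∧
      ∀ (k : ℕ) (H : Module.Basis (Fin k) ℝ (lieAlgebra G hG)),
        r = Module.finrank ℝ (Submodule.span ℝ (Set.range fun i => repDeriv φ (H i) v)) := by
  obtain ⟨D, hD, hexp⟩ := exists_linearMap_eq_repDeriv (hG := hG) hφ
  let L : lieAlgebra G hG →ₗ[ℝ] V := (ContinuousLinearMap.apply ℝ V v).toLinearMap ∘ₗ D
  refine ⟨_, isEmbeddedSubmanifold_orbit (ρ := (unitary _).subtype.comp φ)
    (continuous_subtype_val.comp hφ) hexp v (L := L) fun _ => rfl, fun k H => ?_⟩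
  have hL : (fun i => repDeriv φ (H i) v) = fun i => L (H i) :=
    funext fun i => congrArg (fun T : V →L[ℝ] V => T v) (hD (H i))
  rw [← Submodule.span_range_basis_image L H, hL]

theorem exists_isEmbeddedSubmanifold_repOrbit_complex [CompactSpace G] {V : Type*}
    [NormedAddCommGroup V] [InnerProductSpace ℂ V] [CompleteSpace V] [FiniteDimensional ℂ V]
    {φ : G →* unitary (V →L[ℂ] V)} (hφ : Continuous φ) (v : V) :
    ∃ r : ℕ, IsEmbeddedSubmanifold r (repOrbit φ v) ∧
      ∀ (k : ℕ) (H : Module.Basis (Fin k) ℝ (lieAlgebra G hG)),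
        r = Module.finrank ℝ (Submodule.span ℝ (Set.range fun i => repDeriv φ (H i) v)) := by
  have : FiniteDimensional ℝ V := FiniteDimensional.complexToReal V
  obtain ⟨D, hD, hexp⟩ := exists_linearMap_eq_repDeriv (hG := hG) hφ
  -- The submanifold structure is real, so `φ` is viewed as a real representation. As `res` is
  -- continuous and linear, uniqueness of derivatives identifies the real differential with `res ∘
  -- D`.
  let res : (V →L[ℂ] V) →L[ℝ] (V →L[ℝ] V) :=
    ContinuousLinearMap.restrictScalarsL ℂ V V ℝ ℝ
  let ρ : G →* (V →L[ℝ] V) :=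
    { toFun := fun g => res (φ g)
      map_one' := by rw [map_one]; rfl
      map_mul' := fun g h => by rw [map_mul]; rfl }
  have hρ : Continuous ρ := res.continuous.comp (continuous_subtype_val.comp hφ)
  obtain ⟨D', hD'⟩ := exists_differential (hG := hG) hρ
  have hDD' : ∀ A, D' A = res (D A) := by
    intro A
    have h1 := hasDerivAt_exp_smul_zero (D' A)
    rw [← show (fun t => ρ (expCurve A t)) = _ from funext (hD' A)] at h1
    refine h1.unique ?_
    have h2 := hasDerivAt_repDeriv hφ A
    rw [hD] at h2
    exact res.hasFDerivAt.comp_hasDerivAt 0 h2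
  let L : lieAlgebra G hG →ₗ[ℝ] V := (ContinuousLinearMap.apply ℝ V v).toLinearMap ∘ₗ D'
  refine ⟨_, isEmbeddedSubmanifold_orbit hρ hD' v (L := L) fun _ => rfl, fun k H => ?_⟩
  rw [← Submodule.span_range_basis_image L H]
  have hL : (fun i => repDeriv φ (H i) v) = fun i => L (H i) := funext fun i =>
    (congrArg (fun T : V →L[ℂ] V => T v) (hD (H i))).trans
      (congrArg (fun T : V →L[ℝ] V => T v) (hDD' (H i))).symm
  rw [hL]

end Orbit

/-! ### The defining and adjoint representations. -/

section SpecialCases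

variable {d : ℕ} {G : Subgroup (GL (Fin d) ℂ)} {hG : IsClosed (G : Set (GL (Fin d) ℂ))}

open scoped Matrix.Norms.Operator in
theorem hasDerivAt_expCurve (A : lieAlgebra G hG) :
    HasDerivAt (fun t => ((expCurve A t : G) : GL (Fin d) ℂ).val) A.val 0 :=
  hasDerivAt_exp_smul_zero A.val

theorem continuous_definingRep
    (hU : ∀ g ∈ G, (g : Matrix (Fin d) (Fin d) ℂ) ∈ unitaryGroup (Fin d) ℂ) :
    Continuous (definingRep G hU) := by
  refine Continuous.subtype_mk ?_ _
  have h : Continuous (toEuclideanCLM (n := Fin d) (𝕜 := ℂ)).toAlgEquiv.toLinearMap :=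
    LinearMap.continuous_of_finiteDimensional _
  exact h.comp (Units.continuous_val.comp continuous_subtype_val)

theorem repDeriv_definingRep
    (hU : ∀ g ∈ G, (g : Matrix (Fin d) (Fin d) ℂ) ∈ unitaryGroup (Fin d) ℂ)
    (A : lieAlgebra G hG) :
    repDeriv (definingRep G hU) A =
      toEuclideanCLM (n := Fin d) (𝕜 := ℂ) (A : Matrix (Fin d) (Fin d) ℂ) := by
  open scoped Matrix.Norms.Operator in
  let T : Matrix (Fin d) (Fin d) ℂ →ₗ[ℝ]
      (EuclideanSpace ℂ (Fin d) →L[ℂ] EuclideanSpace ℂ (Fin d)) :=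
    (toEuclideanCLM (n := Fin d) (𝕜 := ℂ)).toAlgEquiv.toLinearMap.restrictScalars ℝ
  exact (T.toContinuousLinearMap.hasFDerivAt.comp_hasDerivAt 0 (hasDerivAt_expCurve A)).deriv

/-- `A` is its own differential in the defining representation, where differentials are
skew-adjoint. -/
theorem lieAlgebra_le_skewAdjoint
    (hU : ∀ g ∈ G, (g : Matrix (Fin d) (Fin d) ℂ) ∈ unitaryGroup (Fin d) ℂ)
    (A : lieAlgebra G hG) :
    (A : Matrix (Fin d) (Fin d) ℂ) ∈ skewAdjoint (Matrix (Fin d) (Fin d) ℂ) := by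
  have h := repDeriv_mem_skewAdjoint (continuous_definingRep hU) A
  rw [repDeriv_definingRep, skewAdjoint.mem_iff] at h
  rw [skewAdjoint.mem_iff]
  refine EquivLike.injective (toEuclideanCLM (n := Fin d) (𝕜 := ℂ)) ?_
  rw [map_star, h, map_neg]

theorem continuous_adjointRep
    (hU : ∀ g ∈ G, (g : Matrix (Fin d) (Fin d) ℂ) ∈ unitaryGroup (Fin d) ℂ) :
    Continuous (adjointRep G hG hU) := by
  -- In finite dimension, norm continuity of operators can be checked on each vector.
  refine continuous_induced_rng.2 (continuous_clm_apply.2 fun B => ?_)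
  have hemb : IsEmbedding (LieAlgebraSpace.toMatrix (G := G) (hG := hG)) :=
    (LinearMap.isClosedEmbedding_of_injective
      (LinearMap.ker_eq_bot.2 LieAlgebraSpace.toMatrix_injective)).isEmbedding
  rw [hemb.continuous_iff]
  have h : Continuous fun g : G => (g : GL (Fin d) ℂ).val :=
    Units.continuous_val.comp continuous_subtype_val
  have h' : Continuous fun g : G => ((g⁻¹ : GL (Fin d) ℂ)).val :=
    Units.continuous_val.comp continuous_subtype_val.inv
  exact (h.mul continuous_const).mul h'

theorem toMatrix_repDeriv_adjointRep
    (hU : ∀ g ∈ G, (g : Matrix (Fin d) (Fin d) ℂ) ∈ unitaryGroup (Fin d) ℂ)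
    (A : lieAlgebra G hG) (B : LieAlgebraSpace G hG) :
    (repDeriv (adjointRep G hG hU) A B).toMatrix =
      (A : Matrix (Fin d) (Fin d) ℂ) * B.toMatrix - B.toMatrix * (A : Matrix (Fin d) (Fin d) ℂ) := by
  open scoped Matrix.Norms.Operator in
  have h1 := (hasDerivAt_repDeriv (continuous_adjointRep (hG := hG) hU) A).clm_apply
    (hasDerivAt_const (0 : ℝ) B)
  have h2 := (LieAlgebraSpace.toMatrix (G := G) (hG := hG)).toContinuousLinearMap.hasFDerivAt
    |>.comp_hasDerivAt 0 h1
  -- The same curve, written `exp (tA) B exp (-tA)`, has derivative `AB - BA` by the product rule.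
  have h3 := ((hasDerivAt_exp_smul_zero A.val).mul_const B.toMatrix).mul
    (hasDerivAt_exp_smul_zero (-A.val))
  have h4 := h2.unique (h3.congr_of_eventuallyEq (Eventually.of_forall fun t => ?_))
  · rw [map_zero, add_zero] at h4
    refine Eq.trans h4 ?_
    simp [NormedSpace.exp_zero, sub_eq_add_neg]
  · change NormedSpace.exp (t • A.val) * B.toMatrix * NormedSpace.exp (-(t • A.val)) = _
    rw [← smul_neg]
    rfl

end SpecialCases

theorem theoremS2 {d : ℕ} (G : Subgroup (GL (Fin d) ℂ))
    (hG : IsClosed (G : Set (GL (Fin d) ℂ)))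
    (hcompact : IsCompact (G : Set (GL (Fin d) ℂ)))
    (hconn : IsConnected (G : Set (GL (Fin d) ℂ))) :
    -- the orbits of a continuous unitary representation `φ` of `G`
    (∀ (V : Type*) [NormedAddCommGroup V] [InnerProductSpace ℂ V] [CompleteSpace V]
        [FiniteDimensional ℂ V] (φ : G →* unitary (V →L[ℂ] V)), Continuous φ →
      (∀ A : lieAlgebra G hG,
        HasDerivAt (fun t : ℝ => (φ (expCurve A t) : V →L[ℂ] V)) (repDeriv φ A) 0) ∧
      IsLinearMap ℝ (repDeriv φ : lieAlgebra G hG → (V →L[ℂ] V)) ∧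
      (∀ A : lieAlgebra G hG, repDeriv φ A ∈ skewAdjoint (V →L[ℂ] V)) ∧
      (Function.Injective φ →
        Function.Injective (repDeriv φ : lieAlgebra G hG → (V →L[ℂ] V))) ∧
      ∀ v : V, IsCompact (repOrbit φ v) ∧
        ∃ r : ℕ, IsEmbeddedSubmanifold r (repOrbit φ v) ∧
          ∀ (k : ℕ) (H : Module.Basis (Fin k) ℝ (lieAlgebra G hG)),
            r = Module.finrank ℝ
              (Submodule.span ℝ (Set.range fun i => repDeriv φ (H i) v))) ∧
    -- the two special cases, for a group `G` of unitary matrices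
    (∀ hU : ∀ g ∈ G, (g : Matrix (Fin d) (Fin d) ℂ) ∈ unitaryGroup (Fin d) ℂ,
      (∀ A : lieAlgebra G hG,
        (A : Matrix (Fin d) (Fin d) ℂ) ∈ skewAdjoint (Matrix (Fin d) (Fin d) ℂ)) ∧
      -- the defining representation
      (Continuous (definingRep G hU) ∧
        ∀ A : lieAlgebra G hG, repDeriv (definingRep G hU) A =
          toEuclideanCLM (n := Fin d) (𝕜 := ℂ) (A : Matrix (Fin d) (Fin d) ℂ)) ∧
      -- the adjoint representation
      (Continuous (adjointRep G hG hU) ∧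
        (∀ A : lieAlgebra G hG,
          HasDerivAt (fun t : ℝ => (adjointRep G hG hU (expCurve A t) :
            LieAlgebraSpace G hG →L[ℝ] LieAlgebraSpace G hG))
            (repDeriv (adjointRep G hG hU) A) 0) ∧
        (∀ A : lieAlgebra G hG, repDeriv (adjointRep G hG hU) A ∈
          skewAdjoint (LieAlgebraSpace G hG →L[ℝ] LieAlgebraSpace G hG)) ∧
        (∀ (A : lieAlgebra G hG) (B : LieAlgebraSpace G hG),
          (repDeriv (adjointRep G hG hU) A B).toMatrix =
            (A : Matrix (Fin d) (Fin d) ℂ) * B.toMatrix -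
              B.toMatrix * (A : Matrix (Fin d) (Fin d) ℂ)) ∧
        ∀ B : LieAlgebraSpace G hG, IsCompact (repOrbit (adjointRep G hG hU) B) ∧
          ∃ r : ℕ, IsEmbeddedSubmanifold r (repOrbit (adjointRep G hG hU) B) ∧
            ∀ (k : ℕ) (H : Module.Basis (Fin k) ℝ (lieAlgebra G hG)),
              r = Module.finrank ℝ (Submodule.span ℝ
                (Set.range fun i => repDeriv (adjointRep G hG hU) (H i) B)))) := by
  have : CompactSpace G := isCompact_iff_compactSpace.1 hcompact
  refine ⟨fun V _ _ _ _ φ hφ => ⟨hasDerivAt_repDeriv hφ, isLinearMap_repDeriv hφ,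
    repDeriv_mem_skewAdjoint hφ, repDeriv_injective hφ, fun v => ⟨isCompact_repOrbit hφ v,
      exists_isEmbeddedSubmanifold_repOrbit_complex hφ v⟩⟩, fun hU =>
    ⟨lieAlgebra_le_skewAdjoint hU, ⟨continuous_definingRep hU, repDeriv_definingRep hU⟩, ?_⟩⟩
  have hφ := continuous_adjointRep (hG := hG) hU
  exact ⟨hφ, hasDerivAt_repDeriv hφ, repDeriv_mem_skewAdjoint hφ, toMatrix_repDeriv_adjointRep hU,
    fun B => ⟨isCompact_repOrbit hφ B, exists_isEmbeddedSubmanifold_repOrbit_real hφ B⟩⟩
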